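/- Let $T$ be a metric space and let $\theta$ be a real function on the finite subsets of $T$ that is the extremal coefficient function (ECF) of some simple max-stable process $Y=\{Y_t\}_{t\in T}$. Here \emph{simple max-stable} means that $\mathbb P(Y_t\le x)=e^{-1/x}$ for all $t\in T$, $x>0$, and that for every $n\ge 1$ the pointwise maximum of $n$ independent copies of $Y$ has the same law as $nY$; the ECF of $Y$ is given by $\theta(\emptyset)=0$ and $\theta(A)=\lim_{x\to\infty}\log\mathbb P(\max_{s\in A}Y_s\le x)/\log\mathbb P(Y_t\le x)$ for finite nonempty $A\subset T$ (the limit does not depend on $t\in T$). Let $X^*=\{X^*_t\}_{t\in T}$ be the Tawn--Molchanov process with ECF $\theta$, that is, the (unique in law) real-valued process such that for all finite nonempty $M\subset T$ and all $x\in(0,\infty)^M$ $$-\log\mathbb P(X^*_t\le x_t,\ t\in M)=\sum_{\emptyset\ne L\subset M}\tau^M_L\max_{t\in L}\frac1{x_t},\qquad \tau^M_L=\sum_{I\subset L}(-1)^{|I|+1}\theta\bigl((M\setminus L)\cup I\bigr).$$ Then the following statements are equivalent: (i) $X^*$ is stochastically continuous, i.e. $\mathbb P(|X^*_{t_n}-X^*_t|>\varepsilon)\to0$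 for all $\varepsilon>0$, $t\in T$ and sequences $t_n\to t$ in $T$; (ii) $\theta$ is continuous, i.e. for every $m\ge0$ the map $T^m\to\mathbb R$, $(t_1,\dots,t_m)\mapsto\theta(\{t_1,\dots,t_m\})$, is continuous; (iii) the map $T\times T\to\mathbb R$, $(s,t)\mapsto\theta(\{s,t\})$, is continuous; (iv) the map $(s,t)\mapsto\theta(\{s,t\})$ is continuous at every point $(t,t)$ of the diagonal. Moreover, for all $s,t\in T$ and $\varepsilon>0$, $$\mathbb P(|X^*_s-X^*_t|>\varepsilon)\le\frac2\varepsilon\bigl(\theta(\{s,t\})-1\bigr).$$ -/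

import Mathlib

open MeasureTheory Filter Topology

noncomputable section

/-- `X` is a simple max-stable process under `P`: each `X t` is a random variable with standard
Fréchet distribution, and for every `n ≥ 1` the pointwise maximum of `n` independent copies of `X`
(realised on the `n`-fold product space) has the same law, on the path space `T → ℝ` with the
product `σ`-algebra, as `n • X`. -/
structure IsSimpleMaxStable {T Ω : Type*} [MeasurableSpace Ω]
    (X : T → Ω → ℝ) (P : Measure Ω) : Prop where
  measurable : ∀ t, Measurable (X t)
  frechet : ∀ t, ∀ x : ℝ, 0 < x → P.real {ω | X t ω ≤ x} = Real.exp (-(1 / x))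
  maxStable : ∀ n : ℕ, 0 < n →
    Measure.map (fun (ω : Fin n → Ω) (t : T) => ⨆ i : Fin n, X t (ω i))
        (Measure.pi fun _ : Fin n => P) =
      Measure.map (fun (ω : Ω) (t : T) => (n : ℝ) * X t ω) P

/-- `θ` is the extremal coefficient function of the process `X`:
`θ ∅ = 0` and `θ A = lim_{x → ∞} log P(max_{s ∈ A} X s ≤ x) / log P(X t ≤ x)` for finite
nonempty `A`. -/
structure IsExtremalCoefficientFunction {T Ω : Type*} [MeasurableSpace Ω]
    (X : T → Ω → ℝ) (P : Measure Ω) (θ : Finset T → ℝ) : Prop where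
  empty : θ ∅ = 0
  tendsto : ∀ A : Finset T, A.Nonempty → ∀ t : T,
    Tendsto (fun x : ℝ =>
        Real.log (P.real {ω | ∀ s ∈ A, X s ω ≤ x}) / Real.log (P.real {ω | X t ω ≤ x}))
      atTop (𝓝 (θ A))

/-- The set of all extremal coefficient functions of simple max-stable processes on `T`.
The process may be taken as the coordinate process on the path space `T → ℝ`, since being simple
max-stable and having a given extremal coefficient function depend on the law only. -/
def ecfSet (T : Type*) : Set (Finset T → ℝ) :=
  {θ | ∃ P : Measure (T → ℝ), IsProbabilityMeasure P ∧
    IsSimpleMaxStable (fun (t : T) (ω : T → ℝ) => ω t) P ∧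
    IsExtremalCoefficientFunction (fun (t : T) (ω : T → ℝ) => ω t) P θ}

/-- The coefficients `τ^M_L = ∑_{I ⊆ L} (-1)^{|I|+1} θ((M \ L) ∪ I)`. -/
def tmCoeff {T : Type*} [DecidableEq T] (θ : Finset T → ℝ) (M L : Finset T) : ℝ :=
  ∑ I ∈ L.powerset, (-1 : ℝ) ^ (I.card + 1) * θ ((M \ L) ∪ I)

/-- `X` is the Tawn–Molchanov process associated with `θ` (which is unique in law): its finite
dimensional distributions are
`-log P(X t ≤ x t, t ∈ M) = ∑_{∅ ≠ L ⊆ M} τ^M_L max_{t ∈ L} 1 / x t`. -/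
structure IsTMProcess {T Ω : Type*} [DecidableEq T] [MeasurableSpace Ω]
    (X : T → Ω → ℝ) (P : Measure Ω) (θ : Finset T → ℝ) : Prop where
  measurable : ∀ t, Measurable (X t)
  fdd : ∀ M : Finset T, M.Nonempty → ∀ x : T → ℝ, (∀ t ∈ M, 0 < x t) →
    P.real {ω | ∀ t ∈ M, X t ω ≤ x t} =
      Real.exp (-∑ L ∈ M.powerset.erase ∅, tmCoeff θ M L * ⨆ t : L, 1 / x t)

/-- Stochastic continuity (continuity in probability) of a process on a topological space, along
sequences. -/
def IsStochasticallyContinuous {T Ω : Type*} [TopologicalSpace T] [MeasurableSpace Ω]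
    (X : T → Ω → ℝ) (P : Measure Ω) : Prop :=
  ∀ ε : ℝ, 0 < ε → ∀ (t : T) (u : ℕ → T), Tendsto u atTop (𝓝 t) →
    Tendsto (fun n => P.real {ω | ε < |X (u n) ω - X t ω|}) atTop (𝓝 0)

/-- A function on the finite subsets of `T` is continuous if for every `m ≥ 0` the induced function
`(t₁, …, tₘ) ↦ f {t₁, …, tₘ}` is continuous on `T ^ m`. -/
def IsContinuousOnFinsets {T : Type*} [DecidableEq T] [TopologicalSpace T]
    (f : Finset T → ℝ) : Prop :=
  ∀ m : ℕ, Continuous fun t : Fin m → T => f (Finset.univ.image t)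

end

/-! The ECF hypothesis enters only through `θ ∅ = 0` and `θ {t} = 1`. For `a ≤ b` the law of a pair
factorises: P(X_s ≤ a, X_t ≤ b) = P(X_s ≤ a) exp(-(θ{s,t} - 1)/b) (`measureReal_pair`). Hence, given
that X_s lies in a slice (kε, (k+1)ε], X_t exceeds (k+1)ε with probability at most (θ{s,t} - 1)/ε;
summing over k and exchanging s and t gives the quantitative bound, and with it (iv) → (i).

Conversely, P(max over M ≤ x) = exp(-θ(M)/x), and convergence in probability of the coordinates
forces these values at x = 1 to converge, which is (i) → (ii). -/

/-- Möbius inversion: with J = L \ I the argument of `θ` becomes M \ J, and the signs summed over I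
⊆ M \ J cancel unless J = M. -/
lemma sum_tmCoeff_powerset {T : Type*} [DecidableEq T] (θ : Finset T → ℝ) (M : Finset T) :
    ∑ L ∈ M.powerset, tmCoeff θ M L = -θ ∅ := by
  have h : ∑ L ∈ M.powerset, tmCoeff θ M L =
      ∑ J ∈ M.powerset, ∑ I ∈ (M \ J).powerset, (-1 : ℝ) ^ (I.card + 1) * θ (M \ J) := by
    unfold tmCoeff
    rw [Finset.sum_sigma', Finset.sum_sigma']
    refine Finset.sum_bij' (fun p _ => ⟨p.1 \ p.2, p.2⟩) (fun p _ => ⟨p.1 ∪ p.2, p.2⟩) ?_ ?_ ?_ ?_ ?_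
    · rintro ⟨L, I⟩ h
      simp only [Finset.mem_sigma, Finset.mem_powerset] at h ⊢
      exact ⟨Finset.sdiff_subset.trans h.1, by grind⟩
    · rintro ⟨J, I⟩ h
      simp only [Finset.mem_sigma, Finset.mem_powerset] at h ⊢
      exact ⟨by grind, by grind⟩
    · rintro ⟨L, I⟩ h
      simp only [Finset.mem_sigma, Finset.mem_powerset] at h
      simp [Finset.sdiff_union_of_subset h.2]
    · rintro ⟨J, I⟩ h
      simp only [Finset.mem_sigma, Finset.mem_powerset] at h
      have : (J ∪ I) \ I = J := by grind
      simp [this]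
    · rintro ⟨L, I⟩ h
      simp only [Finset.mem_sigma, Finset.mem_powerset] at h
      have : M \ L ∪ I = M \ (L \ I) := by grind
      simp [this]
  have hsign (K : Finset T) :
      ∑ I ∈ K.powerset, (-1 : ℝ) ^ (I.card + 1) = if K = ∅ then -1 else 0 := by
    have := congrArg (Int.cast : ℤ → ℝ) (Finset.sum_powerset_neg_one_pow_card (x := K))
    push_cast at this
    simp only [pow_succ, ← Finset.sum_mul, this]
    split_ifs <;> simp
  rw [h, Finset.sum_eq_single M]
  · simp
  · intro J hJ hJM
    rw [← Finset.sum_mul, hsign, if_neg, zero_mul]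
    rw [Finset.sdiff_eq_empty_iff_subset]
    exact fun h' => hJM ((Finset.mem_powerset.1 hJ).antisymm h')
  · simp

lemma sum_tmCoeff_powerset_erase {T : Type*} [DecidableEq T] {θ : Finset T → ℝ} (h0 : θ ∅ = 0)
    (M : Finset T) : ∑ L ∈ M.powerset.erase ∅, tmCoeff θ M L = θ M := by
  have h := sum_tmCoeff_powerset θ M
  rw [← Finset.add_sum_erase _ _ (Finset.empty_mem_powerset M), h0] at h
  have h' : tmCoeff θ M ∅ = -θ M := by simp [tmCoeff]
  linarith

lemma ecf_empty {T : Type*} {θ : Finset T → ℝ} (hθ : θ ∈ ecfSet T) : θ ∅ = 0 := by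
  obtain ⟨P, -, -, h⟩ := hθ
  exact h.empty

lemma ecf_singleton {T : Type*} {θ : Finset T → ℝ} (hθ : θ ∈ ecfSet T) (t : T) : θ {t} = 1 := by
  obtain ⟨P, -, hs, h⟩ := hθ
  refine tendsto_nhds_unique (h.tendsto {t} (Finset.singleton_nonempty t) t) ?_
  refine tendsto_const_nhds.congr' ?_
  filter_upwards [eventually_gt_atTop 0] with x hx
  have hx' : -(1 / x) ≠ 0 := by simp [hx.ne']
  simp only [Finset.mem_singleton, forall_eq, hs.frechet t x hx, Real.log_exp]
  rw [div_self hx']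

/-! ### Laws of the Tawn–Molchanov process and the deviation bound -/

namespace IsTMProcess

variable {T Ω : Type*} [DecidableEq T] [MeasurableSpace Ω] {X : T → Ω → ℝ} {P : Measure Ω}
  {θ : Finset T → ℝ}

lemma measureReal_forall_le [IsProbabilityMeasure P] (hX : IsTMProcess X P θ) (h0 : θ ∅ = 0)
    (M : Finset T) {x : ℝ} (hx : 0 < x) :
    P.real {ω | ∀ t ∈ M, X t ω ≤ x} = Real.exp (-(θ M / x)) := by
  rcases M.eq_empty_or_nonempty with rfl | hM
  · simp [h0]
  · rw [hX.fdd M hM (fun _ => x) fun _ _ => hx]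
    congr 2
    rw [← sum_tmCoeff_powerset_erase h0 M, Finset.sum_div]
    refine Finset.sum_congr rfl fun L hL => ?_
    have : Nonempty L :=
      (Finset.nonempty_iff_ne_empty.2 (Finset.ne_of_mem_erase hL)).to_subtype
    rw [ciSup_const, mul_one_div]

lemma measureReal_le [IsProbabilityMeasure P] (hX : IsTMProcess X P θ) (h0 : θ ∅ = 0)
    (h1 : ∀ t, θ {t} = 1) (t : T) {x : ℝ} (hx : 0 < x) :
    P.real {ω | X t ω ≤ x} = Real.exp (-(1 / x)) := by
  simpa [h1] using hX.measureReal_forall_le h0 {t} hx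

lemma one_le_pair [IsProbabilityMeasure P] (hX : IsTMProcess X P θ) (h0 : θ ∅ = 0)
    (h1 : ∀ t, θ {t} = 1) (s t : T) : 1 ≤ θ {s, t} := by
  have h := hX.measureReal_forall_le h0 {s, t} one_pos
  have h' := hX.measureReal_le h0 h1 s one_pos
  have : P.real {ω | ∀ r ∈ ({s, t} : Finset T), X r ω ≤ 1} ≤ P.real {ω | X s ω ≤ 1} :=
    measureReal_mono fun ω hω => hω s (by simp)
  rw [h, h', Real.exp_le_exp] at this
  linarith

lemma measureReal_le_zero [IsProbabilityMeasure P] (hX : IsTMProcess X P θ) (h0 : θ ∅ = 0)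
    (h1 : ∀ t, θ {t} = 1) (t : T) : P.real {ω | X t ω ≤ 0} = 0 := by
  refine le_antisymm ?_ measureReal_nonneg
  have hlim : Tendsto (fun x : ℝ => Real.exp (-(1 / x))) (𝓝[>] 0) (𝓝 0) := by
    simp only [one_div]
    exact Real.tendsto_exp_neg_atTop_nhds_zero.comp tendsto_inv_nhdsGT_zero
  refine ge_of_tendsto hlim ?_
  filter_upwards [self_mem_nhdsWithin] with x hx
  rw [← hX.measureReal_le h0 h1 t hx]
  exact measureReal_mono fun ω (hω : X t ω ≤ 0) => hω.trans (le_of_lt hx)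

/-- Below the diagonal the joint distribution function of a pair factorises. -/
lemma measureReal_pair [IsProbabilityMeasure P] (hX : IsTMProcess X P θ) (h0 : θ ∅ = 0)
    (h1 : ∀ t, θ {t} = 1) {s t : T} (hst : s ≠ t) {a b : ℝ} (hab : a ≤ b) (hb : 0 < b) :
    P.real {ω | X s ω ≤ a ∧ X t ω ≤ b} =
      P.real {ω | X s ω ≤ a} * Real.exp (-((θ {s, t} - 1) / b)) := by
  -- `fdd` covers only positive thresholds, but the slice k = 0 has a = 0; there both sides vanish.
  rcases le_or_gt a 0 with ha | ha
  · have hz : P.real {ω | X s ω ≤ a} = 0 :=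
      le_antisymm ((measureReal_mono fun ω (hω : X s ω ≤ a) => hω.trans ha).trans_eq
        (hX.measureReal_le_zero h0 h1 s)) measureReal_nonneg
    rw [hz, zero_mul]
    exact le_antisymm ((measureReal_mono fun ω hω => hω.1).trans_eq hz) measureReal_nonneg
  · have hts : t ≠ s := hst.symm
    have h := hX.fdd {s, t} (by simp) (fun r => if r = s then a else b)
      (fun r _ => by split_ifs <;> linarith)
    have hset : {ω | ∀ r ∈ ({s, t} : Finset T), X r ω ≤ if r = s then a else b} =
        {ω | X s ω ≤ a ∧ X t ω ≤ b} := by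
      ext ω; simp [hts]
    have hpow : ({s, t} : Finset T).powerset.erase ∅ = {{s}, {t}, {s, t}} := by
      ext L
      simp only [ne_eq, Finset.mem_erase, Finset.mem_powerset, Finset.mem_insert,
        Finset.mem_singleton, ← Finset.coe_subset, ← Finset.coe_inj, Finset.coe_insert, Finset.coe_singleton,
        Finset.coe_empty, Set.subset_pair_iff_eq]
      constructor
      · tauto
      · rintro (h | h | h) <;> simp [h, (Set.insert_nonempty s {t}).ne_empty]
    have hd1 : ({s, t} : Finset T) \ {s} = {t} := by grind
    have hd2 : ({s, t} : Finset T) \ {t} = {s} := by grind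
    have hτs : tmCoeff θ {s, t} {s} = θ {s, t} - 1 := by
      have : ({s} : Finset T).powerset = {∅, {s}} := rfl
      rw [tmCoeff, hd1, this, Finset.sum_pair (by simp)]
      have : ({t} ∪ {s} : Finset T) = {s, t} := by grind
      simp [this, h1]; ring
    have hτt : tmCoeff θ {s, t} {t} = θ {s, t} - 1 := by
      have : ({t} : Finset T).powerset = {∅, {t}} := rfl
      rw [tmCoeff, hd2, this, Finset.sum_pair (by simp)]
      have : ({s} ∪ {t} : Finset T) = {s, t} := by grind
      simp [this, h1]; ring
    have hne1 : ({s} : Finset T) ∉ ({{t}, {s, t}} : Finset (Finset T)) := by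
      simp only [Finset.mem_insert, Finset.mem_singleton, Finset.singleton_inj, hst, false_or]
      exact fun h => hts (Finset.mem_singleton.1 (h ▸ by simp))
    have hne2 : ({t} : Finset T) ≠ {s, t} :=
      fun h => hst (Finset.mem_singleton.1 (h ▸ by simp))
    -- The coefficient of the full pair is read off from the total `θ {s, t}`.
    have hτ := sum_tmCoeff_powerset_erase h0 ({s, t} : Finset T)
    rw [hpow, Finset.sum_insert hne1, Finset.sum_pair hne2, hτs, hτt] at hτ
    have hτst : tmCoeff θ {s, t} {s, t} = 2 - θ {s, t} := by linarith
    have hsup : (⨆ r : ({s, t} : Finset T), 1 / (if (r : T) = s then a else b)) = 1 / a := by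
      have : Nonempty ({s, t} : Finset T) := ⟨⟨s, by simp⟩⟩
      refine le_antisymm (ciSup_le fun r => ?_) ?_
      · split_ifs
        · rfl
        · exact one_div_le_one_div_of_le ha hab
      · refine le_ciSup_of_le (Set.finite_range _).bddAbove ⟨s, by simp⟩ ?_
        simp
    rw [hset, hpow, Finset.sum_insert hne1, Finset.sum_pair hne2, hτs, hτt, hτst, hsup] at h
    rw [h, hX.measureReal_le h0 h1 s ha, ← Real.exp_add]
    have hs : (⨆ r : ({s} : Finset T), 1 / (if (r : T) = s then a else b)) = 1 / a := by
      simp [ciSup_unique]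
    have ht : (⨆ r : ({t} : Finset T), 1 / (if (r : T) = s then a else b)) = 1 / b := by
      simp [ciSup_unique, hts]
    rw [hs, ht]
    congr 1
    ring

/-- The exponential factor depends on b alone, so subtracting the factorisations at thresholds a and
b for X_s leaves the slice probability times 1 - exp(-(θ{s,t} - 1)/b); then 1 - e^{-u} ≤ u. -/
lemma measureReal_Ioc_lt_le [IsProbabilityMeasure P] (hX : IsTMProcess X P θ) (h0 : θ ∅ = 0)
    (h1 : ∀ t, θ {t} = 1) {s t : T} (hst : s ≠ t) {a b : ℝ} (hab : a ≤ b) (hb : 0 < b) :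
    P.real {ω | (a < X s ω ∧ X s ω ≤ b) ∧ b < X t ω} ≤
      (θ {s, t} - 1) / b * P.real {ω | a < X s ω ∧ X s ω ≤ b} := by
  have ms (c : ℝ) : MeasurableSet {ω | X s ω ≤ c} := measurableSet_le (hX.measurable s) measurable_const
  have mt : MeasurableSet {ω | X t ω ≤ b} := measurableSet_le (hX.measurable t) measurable_const
  have e1 : P.real {ω | a < X s ω ∧ X s ω ≤ b} =
      P.real {ω | X s ω ≤ b} - P.real {ω | X s ω ≤ a} := by
    have hsub : {ω | X s ω ≤ a} ⊆ {ω | X s ω ≤ b} := fun ω hω => le_trans hω hab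
    rw [← measureReal_sdiff hsub (ms a)]
    congr 1; ext ω; simp [and_comm]
  have e2 : P.real {ω | (a < X s ω ∧ X s ω ≤ b) ∧ X t ω ≤ b} =
      P.real {ω | X s ω ≤ b ∧ X t ω ≤ b} - P.real {ω | X s ω ≤ a ∧ X t ω ≤ b} := by
    have hsub : {ω | X s ω ≤ a ∧ X t ω ≤ b} ⊆ {ω | X s ω ≤ b ∧ X t ω ≤ b} :=
      fun ω hω => ⟨hω.1.trans hab, hω.2⟩
    rw [← measureReal_sdiff hsub ((ms a).inter mt)]
    congr 1; ext ω
    simp only [Set.mem_ofPred_eq, Set.mem_sdiff, not_and, not_le]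
    grind
  have e3 := measureReal_inter_add_sdiff (μ := P) (s := {ω | a < X s ω ∧ X s ω ≤ b}) mt
  have e4 : {ω | a < X s ω ∧ X s ω ≤ b} \ {ω | X t ω ≤ b} =
      {ω | (a < X s ω ∧ X s ω ≤ b) ∧ b < X t ω} := by
    ext ω; simp
  rw [e4, show {ω | a < X s ω ∧ X s ω ≤ b} ∩ {ω | X t ω ≤ b} =
    {ω | (a < X s ω ∧ X s ω ≤ b) ∧ X t ω ≤ b} from rfl, e2,
    hX.measureReal_pair h0 h1 hst le_rfl hb, hX.measureReal_pair h0 h1 hst hab hb, ← sub_mul,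
    ← e1] at e3
  have hexp := Real.add_one_le_exp (-((θ {s, t} - 1) / b))
  have hp : 0 ≤ P.real {ω | a < X s ω ∧ X s ω ≤ b} := measureReal_nonneg
  nlinarith

lemma measureReal_add_lt_le [IsProbabilityMeasure P] (hX : IsTMProcess X P θ) (h0 : θ ∅ = 0)
    (h1 : ∀ t, θ {t} = 1) {s t : T} (hst : s ≠ t) {ε : ℝ} (hε : 0 < ε) :
    P.real {ω | X s ω + ε < X t ω} ≤ (θ {s, t} - 1) / ε := by
  have hθ := sub_nonneg.2 (hX.one_le_pair h0 h1 s t)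
  set B : ℕ → Set Ω := fun k => {ω | k * ε < X s ω ∧ X s ω ≤ (k + 1) * ε} with hB
  set C : ℕ → Set Ω := fun k =>
    {ω | (k * ε < X s ω ∧ X s ω ≤ (k + 1) * ε) ∧ (k + 1) * ε < X t ω} with hC
  have hBm (k : ℕ) : MeasurableSet (B k) :=
    (measurableSet_lt measurable_const (hX.measurable s)).inter
      (measurableSet_le (hX.measurable s) measurable_const)
  have hBd : Pairwise (Function.onFun Disjoint B) := by
    refine (pairwise_disjoint_on B).2 fun i j hij => Set.disjoint_left.2 fun ω hi hj => ?_
    have : ((i : ℝ) + 1) * ε ≤ j * ε := by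
      gcongr; exact_mod_cast hij
    exact absurd (hi.2.trans this) hj.1.not_ge
  have hCB (k : ℕ) : P (C k) ≤ ENNReal.ofReal ((θ {s, t} - 1) / ε) * P (B k) := by
    have hk : (0 : ℝ) ≤ k := k.cast_nonneg
    have h := hX.measureReal_Ioc_lt_le h0 h1 hst (a := k * ε) (b := (k + 1) * ε)
      (by nlinarith) (by positivity)
    have h' : P.real (C k) ≤ (θ {s, t} - 1) / ε * P.real (B k) := by
      refine h.trans (mul_le_mul_of_nonneg_right ?_ measureReal_nonneg)
      exact div_le_div_of_nonneg_left hθ hε (by nlinarith)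
    rw [← ofReal_measureReal (s := C k), ← ofReal_measureReal (s := B k),
      ← ENNReal.ofReal_mul (by positivity)]
    exact ENNReal.ofReal_le_ofReal h'
  have hsub : {ω | X s ω + ε < X t ω} ⊆ {ω | X s ω ≤ 0} ∪ ⋃ k, C k := by
    intro ω hω
    rcases le_or_gt (X s ω) 0 with h | h
    · exact Or.inl h
    · refine Or.inr (Set.mem_iUnion.2 ?_)
      -- The slice is k = ⌈X_s/ε⌉ - 1; since (k+1)ε < X_s + ε, the jump carries X_t past its right
      -- end.
      have hpos : 0 < ⌈X s ω / ε⌉₊ := Nat.ceil_pos.2 (div_pos h hε)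
      obtain ⟨k, hk⟩ := Nat.exists_eq_succ_of_ne_zero hpos.ne'
      have hk' := (Nat.ceil_eq_iff (by omega)).1 hk
      simp only [Nat.succ_eq_add_one, Nat.add_sub_cancel, Nat.cast_add, Nat.cast_one,
        lt_div_iff₀ hε, div_le_iff₀ hε] at hk'
      refine ⟨k, hk', ?_⟩
      have : X s ω + ε < X t ω := hω
      linarith [hk'.1]
  have hz : P {ω | X s ω ≤ 0} = 0 :=
    (measureReal_eq_zero_iff).1 (hX.measureReal_le_zero h0 h1 s)
  refine ENNReal.toReal_le_of_le_ofReal (by positivity) ?_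
  calc P {ω | X s ω + ε < X t ω} ≤ P {ω | X s ω ≤ 0} + P (⋃ k, C k) :=
        (measure_mono hsub).trans (measure_union_le _ _)
    _ = P (⋃ k, C k) := by rw [hz, zero_add]
    _ ≤ ∑' k, P (C k) := measure_iUnion_le _
    _ ≤ ∑' k, ENNReal.ofReal ((θ {s, t} - 1) / ε) * P (B k) := ENNReal.tsum_le_tsum hCB
    _ = ENNReal.ofReal ((θ {s, t} - 1) / ε) * P (⋃ k, B k) := by
        rw [ENNReal.tsum_mul_left, measure_iUnion hBd hBm]
    _ ≤ ENNReal.ofReal ((θ {s, t} - 1) / ε) := mul_le_of_le_one_right' prob_le_one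

lemma measureReal_lt_abs_sub_le [IsProbabilityMeasure P] (hX : IsTMProcess X P θ) (h0 : θ ∅ = 0)
    (h1 : ∀ t, θ {t} = 1) (s t : T) {ε : ℝ} (hε : 0 < ε) :
    P.real {ω | ε < |X s ω - X t ω|} ≤ 2 / ε * (θ {s, t} - 1) := by
  rcases eq_or_ne s t with rfl | hst
  · simp [h1, not_lt.2 hε.le]
  · have hsub : {ω | ε < |X s ω - X t ω|} ⊆
        {ω | X s ω + ε < X t ω} ∪ {ω | X t ω + ε < X s ω} := by
      intro ω (hω : ε < |X s ω - X t ω|)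
      rcases lt_abs.1 hω with h | h
      · exact Or.inr (show X t ω + ε < X s ω by linarith)
      · exact Or.inl (show X s ω + ε < X t ω by linarith)
    have h₁ := hX.measureReal_add_lt_le h0 h1 hst hε
    have h₂ := hX.measureReal_add_lt_le h0 h1 hst.symm hε
    rw [Finset.pair_comm] at h₂
    calc _ ≤ _ := (measureReal_mono hsub).trans (measureReal_union_le _ _)
      _ ≤ _ := add_le_add h₁ h₂
      _ = _ := by ring

lemma isStochasticallyContinuous [IsProbabilityMeasure P] [TopologicalSpace T]
    (hX : IsTMProcess X P θ) (h0 : θ ∅ = 0) (h1 : ∀ t, θ {t} = 1)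
    (h : ∀ t : T, ContinuousAt (fun p : T × T => θ {p.1, p.2}) (t, t)) :
    IsStochasticallyContinuous X P := by
  intro ε hε t u hu
  have hlim : Tendsto (fun n => 2 / ε * (θ {u n, t} - 1)) atTop (𝓝 0) := by
    have h2 : Tendsto (fun n => (u n, t)) atTop (𝓝 (t, t)) := hu.prodMk_nhds tendsto_const_nhds
    have h3 := (((h t).tendsto.comp h2).sub_const 1).const_mul (2 / ε)
    simpa [Function.comp_def, h1] using h3
  exact squeeze_zero (fun _ => measureReal_nonneg)
    (fun n => hX.measureReal_lt_abs_sub_le h0 h1 (u n) t hε) hlim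

/-! ### From stochastic continuity to continuity of the ECF -/

lemma exp_neg_div_le_add_sum [IsProbabilityMeasure P] (hX : IsTMProcess X P θ) (h0 : θ ∅ = 0)
    {m : ℕ} (u v : Fin m → T) {x δ : ℝ} (hx : 0 < x) (hδ : 0 < δ) :
    Real.exp (-(θ (Finset.univ.image u) / x)) ≤
      Real.exp (-(θ (Finset.univ.image v) / (x + δ))) +
        ∑ i, P.real {ω | δ < |X (u i) ω - X (v i) ω|} := by
  rw [← hX.measureReal_forall_le h0 _ hx, ← hX.measureReal_forall_le h0 _ (add_pos hx hδ)]
  have hsub : {ω | ∀ t ∈ Finset.univ.image u, X t ω ≤ x} ⊆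
      {ω | ∀ t ∈ Finset.univ.image v, X t ω ≤ x + δ} ∪
        ⋃ i, {ω | δ < |X (u i) ω - X (v i) ω|} := by
    intro ω hω
    by_cases h : ∃ i, δ < |X (u i) ω - X (v i) ω|
    · exact Or.inr (Set.mem_iUnion.2 h)
    · push Not at h
      left
      simp only [Finset.mem_image, Finset.mem_univ, true_and, forall_exists_index,
        forall_apply_eq_imp_iff, Set.mem_ofPred_eq] at hω ⊢
      intro i
      linarith [hω i, (abs_le.1 (h i)).1]
  calc _ ≤ _ := (measureReal_mono hsub).trans (measureReal_union_le _ _)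
    _ ≤ _ := by gcongr; exact measureReal_iUnion_fintype_le _

lemma isContinuousOnFinsets [IsProbabilityMeasure P] [TopologicalSpace T] [FirstCountableTopology T]
    (hX : IsTMProcess X P θ) (h0 : θ ∅ = 0) (h : IsStochasticallyContinuous X P) :
    IsContinuousOnFinsets θ := by
  intro m
  refine continuous_iff_seqContinuous.2 fun u v huv => ?_
  rw [tendsto_pi_nhds] at huv
  set c := θ (Finset.univ.image v) with hc
  have herr (δ : ℝ) (hδ : 0 < δ) :
      Tendsto (fun n => ∑ i, P.real {ω | δ < |X (u n i) ω - X (v i) ω|}) atTop (𝓝 0) := by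
    simpa using tendsto_finsetSum Finset.univ fun i _ => h δ hδ (v i) (fun n => u n i) (huv i)
  have hcont : ContinuousAt (fun δ : ℝ => Real.exp (-(c / (1 + δ)))) 0 := by
    fun_prop (disch := norm_num)
  have hcont' : ContinuousAt (fun δ : ℝ => Real.exp (-(c / (1 - δ)))) 0 := by
    fun_prop (disch := norm_num)
  have hexp : Tendsto (fun n => Real.exp (-θ (Finset.univ.image (u n)))) atTop
      (𝓝 (Real.exp (-c))) := by
    refine tendsto_order.2 ⟨fun a ha => ?_, fun a ha => ?_⟩
    · have hev : ∀ᶠ δ in 𝓝 (0 : ℝ), a < Real.exp (-(c / (1 - δ))) :=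
        hcont'.eventually (lt_mem_nhds (by simpa using ha))
      obtain ⟨δ, ⟨hδ, hδ1⟩, hδ0⟩ := (((hev.and (gt_mem_nhds one_pos)).filter_mono
        nhdsWithin_le_nhds).and (self_mem_nhdsWithin (s := Set.Ioi (0 : ℝ)))).exists
      filter_upwards [(herr δ hδ0).eventually (gt_mem_nhds (sub_pos.2 hδ))] with n hn
      -- Starting at 1 - δ makes the enlarged threshold exactly 1.
      have := hX.exp_neg_div_le_add_sum h0 v (u n) (sub_pos.2 hδ1) hδ0
      simp only [sub_add_cancel, div_one, abs_sub_comm (X (v _) _)] at this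
      linarith
    · have hev : ∀ᶠ δ in 𝓝 (0 : ℝ), Real.exp (-(c / (1 + δ))) < a :=
        hcont.eventually (gt_mem_nhds (by simpa using ha))
      obtain ⟨δ, hδ, hδ0⟩ := ((hev.filter_mono
        nhdsWithin_le_nhds).and (self_mem_nhdsWithin (s := Set.Ioi (0 : ℝ)))).exists
      filter_upwards [(herr δ hδ0).eventually (gt_mem_nhds (sub_pos.2 hδ))] with n hn
      have := hX.exp_neg_div_le_add_sum h0 (u n) v one_pos hδ0
      simp only [div_one] at this
      linarith
  simpa [Function.comp_def] using (hexp.log (Real.exp_ne_zero _)).neg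

end IsTMProcess

lemma IsContinuousOnFinsets.continuous_pair {T : Type*} [DecidableEq T] [TopologicalSpace T]
    {f : Finset T → ℝ} (hf : IsContinuousOnFinsets f) :
    Continuous fun p : T × T => f {p.1, p.2} := by
  have h : Continuous fun p : T × T => (![p.1, p.2] : Fin 2 → T) := by
    refine continuous_pi fun i => ?_
    fin_cases i
    · exact continuous_fst
    · exact continuous_snd
  refine ((hf 2).comp h).congr fun p => congrArg f ?_
  ext r
  simp [Fin.exists_fin_two, eq_comm]

theorem theorem4 {T : Type*} [MetricSpace T] [DecidableEq T]
    (θ : Finset T → ℝ) (hθ : θ ∈ ecfSet T)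
    {Ω : Type*} [MeasurableSpace Ω] (P : Measure Ω) [IsProbabilityMeasure P]
    (X : T → Ω → ℝ) (hX : IsTMProcess X P θ) :
    List.TFAE [
      IsStochasticallyContinuous X P,
      IsContinuousOnFinsets θ,
      Continuous (fun p : T × T => θ {p.1, p.2}),
      ∀ t : T, ContinuousAt (fun p : T × T => θ {p.1, p.2}) (t, t)] ∧
    ∀ (s t : T) (ε : ℝ), 0 < ε →
      P.real {ω | ε < |X s ω - X t ω|} ≤ 2 / ε * (θ {s, t} - 1) := by
  have h0 := ecf_empty hθ
  have h1 := ecf_singleton hθ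
  refine ⟨?_, fun s t ε hε => hX.measureReal_lt_abs_sub_le h0 h1 s t hε⟩
  tfae_have 1 → 2 := hX.isContinuousOnFinsets h0
  tfae_have 2 → 3 := fun h => h.continuous_pair
  tfae_have 3 → 4 := fun h t => h.continuousAt
  tfae_have 4 → 1 := hX.isStochasticallyContinuous h0 h1
  tfae_finish
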